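/- Let $p$ be a prime. All groups are abelian, and for an endomorphism $\phi$ of a group $G$ and a subgroup $X\le G$ put $\hat\phi(X)=(\phi(X)+X)/X$. A subgroup $X$ of $G$ is fully inert (respectively, characteristically inert) if $\hat\phi(X)$ is finite for every endomorphism (respectively, automorphism) $\phi$ of $G$; it is uniformly characteristically inert if there is an integer $m$ such that $|\hat\phi(X)|\le m$ for every automorphism $\phi$ of $G$. Two subgroups are commensurable if their intersection has finite index in each of them. The group $G$ has minimal full inertia (respectively, minimal characteristic inertia) if every fully inert (respectively, characteristically inert) subgroup of $G$ is commensurable with some fully invariant (respectively, characteristic) subgroup of $G$. Let $B=\bigoplus_{n<\omega}\mathbb Z_{p^{n+1}}$ be the standard direct sum of cyclic $p$-groups, where $\mathbb Z_{p^{n+1}}$ is the cyclic group of order $p^{n+1}$, and let $\overline B$ be its torsion completion, that is, the torsion subgroup of the $p$-adic completion $\varprojlim_n B/p^nB$. Then $G=B\oplus\overline B$ is a $p$-group that has neither minimal full inertia nor minimal characteristic inertia. Moreover, the subgroup $X=0\oplus\overline B[p]$ of $G$, where $\overline B[p]=\{y\in\overline B: py=0\}$, is fully inert, but it is not uniformly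 characteristically inert and not commensurable with any characteristic subgroup of $G$. -/

import Mathlib

open scoped DirectSum

section Inertia

variable {G : Type*} [AddCommGroup G]

/-- `φ̂(X) = (φ(X) + X) / X` for an endomorphism `φ` of `G` and a subgroup `X` of `G`. -/
abbrev InertiaQuotient (φ : G →+ G) (X : AddSubgroup G) : Type _ :=
  ↥(X.map φ ⊔ X) ⧸ X.addSubgroupOf (X.map φ ⊔ X)

/-- `X` is fully invariant in `G`: every endomorphism of `G` maps `X` into itself. -/
def IsFullyInvariantSubgroup (X : AddSubgroup G) : Prop :=
  ∀ φ : G →+ G, X.map φ ≤ X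

/-- `X` is fully inert in `G`: `φ̂(X)` is finite for every endomorphism `φ` of `G`. -/
def IsFullyInert (X : AddSubgroup G) : Prop :=
  ∀ φ : G →+ G, Finite (InertiaQuotient φ X)

/-- `X` is characteristically inert in `G`: `φ̂(X)` is finite for every automorphism `φ`. -/
def IsCharacteristicallyInert (X : AddSubgroup G) : Prop :=
  ∀ φ : G ≃+ G, Finite (InertiaQuotient (φ : G →+ G) X)

/-- `X` is uniformly characteristically inert in `G`: the quotients `φ̂(X)`, for `φ` an
automorphism of `G`, are finite, with one bound on their orders that does not depend on `φ`. -/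
def IsUniformlyCharacteristicallyInert (X : AddSubgroup G) : Prop :=
  ∃ m : ℕ, ∀ φ : G ≃+ G, Finite (InertiaQuotient (φ : G →+ G) X) ∧
    Nat.card (InertiaQuotient (φ : G →+ G) X) ≤ m

/-- `G` has minimal full inertia: every fully inert subgroup of `G` is commensurable with some
fully invariant subgroup of `G`. -/
def HasMinimalFullInertia (G : Type*) [AddCommGroup G] : Prop :=
  ∀ X : AddSubgroup G, IsFullyInert X →
    ∃ Y : AddSubgroup G, IsFullyInvariantSubgroup Y ∧ X.Commensurable Y

/-- `G` has minimal characteristic inertia: every characteristically inert subgroup of `G` is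
commensurable with some characteristic subgroup of `G`. -/
def HasMinimalCharacteristicInertia (G : Type*) [AddCommGroup G] : Prop :=
  ∀ X : AddSubgroup G, IsCharacteristicallyInert X →
    ∃ Y : AddSubgroup G, Y.Characteristic ∧ X.Commensurable Y

/-- The abelian group `G` is a `p`-group: every element has order a power of `p`. -/
def IsAddPGroup (p : ℕ) (G : Type*) [AddCommGroup G] : Prop :=
  ∀ x : G, ∃ k : ℕ, p ^ k • x = 0

end Inertia

/-- The standard direct sum of cyclic `p`-groups, `B = ⨁ₙ ℤ / p ^ (n + 1)`. -/
abbrev StandardB (p : ℕ) : Type := ⨁ n : ℕ, ZMod (p ^ (n + 1))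

/-- The torsion completion of an abelian `p`-group `A`: the torsion subgroup of the `p`-adic
completion `lim A / p ^ n A` of `A`. -/
abbrev TorsionCompletion (p : ℕ) (A : Type*) [AddCommGroup A] : Type _ :=
  ↥(AddCommGroup.torsion (AdicCompletion (Ideal.span {(p : ℤ)}) A))

/-- The subgroup `0 ⊕ Ā[p]` of `A ⊕ Ā`, where `Ā` is the torsion completion of `A` and `Ā[p]` is
the subgroup of all `y` in `Ā` with `p y = 0`. -/
noncomputable def zeroSumSocle (p : ℕ) (A : Type*) [AddCommGroup A] :
    AddSubgroup (A × TorsionCompletion p A) :=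
  (⊥ : AddSubgroup A).prod (AddSubgroup.torsionBy (TorsionCompletion p A) (p : ℤ))

/-!
The torsion completion of `B = ⨁ ℤ / p ^ (k + 1)` is described by coordinates
`torsionCoord p k` with values in `ℤ / p ^ (k + 1)`. They separate points (`torsionCoord_ext`), and
every family of coordinates killed by a fixed power of `p` occurs (`exists_torsionCoord_eq`). All
further arguments use these two facts only. Write `B̄` for the torsion completion and `X` for the
subgroup `0 ⊕ B̄[p]` of `B ⊕ B̄`.

Full inertia of `X`: an endomorphism `φ` maps `X` into the socle, so `X` has in `X + φ(X)` an
index equal to the order of the projection of `φ(X)` to `B` (`relIndex_zeroSumSocle`). That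
projection is the image of `B̄[p]` under a homomorphism `B̄ → B`, and it is finite
(`finite_image_socle`). The reason is that a homomorphism to `B` kills all socle elements whose
coordinates vanish far enough. If there were counterexamples arbitrarily far out, some of them
could be chosen with images in disjoint blocks of summands; their infinite sum exists in `B̄`, and
since homomorphisms are `p`-adically continuous, its image would have infinite support in `B`.

Lack of uniformity: the automorphism `(b, y) ↦ (b + y_N, y)`, where `y_N` consists of the first `N`
coordinates of `y`, maps `X` to a subgroup whose projection to `B` has at least `N` elements.

Finally, a subgroup commensurable with a characteristic subgroup is uniformly characteristically
inert, because the index of a characteristic subgroup is the same over all automorphic images.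
So `X` is not commensurable with any characteristic, let alone fully invariant, subgroup, and it
refutes minimal full inertia and minimal characteristic inertia at once.
-/

/-! ### Divisibility in the standard direct sum -/

open DirectSum in
theorem StandardB.mem_pow_smul_top_iff (p m : ℕ) (b : StandardB p) :
    b ∈ (Ideal.span {(p : ℤ)} ^ m • ⊤ : Submodule ℤ (StandardB p)) ↔
      ∀ k, ∃ a : ZMod (p ^ (k + 1)), b k = (p : ZMod (p ^ (k + 1))) ^ m * a := by
  rw [Ideal.span_singleton_pow, Submodule.ideal_span_singleton_smul]
  constructor
  · intro h k
    obtain ⟨c, -, rfl⟩ := Submodule.mem_smul_pointwise_iff_exists _ _ _ |>.1 h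
    refine ⟨c k, ?_⟩
    change ((p : ℤ) ^ m • c : StandardB p) k = _
    rw [DirectSum.smul_apply, zsmul_eq_mul]
    push_cast
    rfl
  · intro h
    classical
    rw [← DirectSum.sum_support_of b]
    refine Submodule.sum_mem _ fun k _ ↦ ?_
    obtain ⟨a, ha⟩ := h k
    refine Submodule.mem_smul_pointwise_iff_exists _ _ _ |>.2 ⟨of _ k a, trivial, ?_⟩
    rw [ha, ← map_zsmul, zsmul_eq_mul]
    push_cast
    rfl

theorem ZMod.exists_eq_pow_mul_of_pow_mul_eq_zero {p : ℕ} (hp : p.Prime) {n k : ℕ}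
    {a : ZMod (p ^ (k + 1))} (h : (p : ZMod (p ^ (k + 1))) ^ n * a = 0) :
    ∃ u : ZMod (p ^ (k + 1)), a = (p : ZMod (p ^ (k + 1))) ^ (k + 1 - n) * u := by
  have : NeZero (p ^ (k + 1)) := ⟨pow_ne_zero _ hp.ne_zero⟩
  obtain ⟨v, rfl⟩ := ZMod.natCast_zmod_surjective a
  have h' : p ^ (k + 1) ∣ p ^ n * v := by
    rw [← ZMod.natCast_eq_zero_iff]
    exact_mod_cast h
  have h2 : p ^ (k + 1 - n) ∣ v := by
    rcases le_total n (k + 1) with hn | hn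
    · have h3 : p ^ n * p ^ (k + 1 - n) ∣ p ^ n * v := by
        rwa [← pow_add, Nat.add_sub_cancel' hn]
      exact Nat.dvd_of_mul_dvd_mul_left (pow_pos hp.pos n) h3
    · simp [Nat.sub_eq_zero_of_le hn]
  obtain ⟨w, rfl⟩ := h2
  exact ⟨w, by push_cast; rfl⟩

/-! ### Coordinates on the completion -/

/-- The `p`-adic completion of the standard direct sum `B`. -/
abbrev CompletedB (p : ℕ) : Type := AdicCompletion (Ideal.span {(p : ℤ)}) (StandardB p)

theorem StandardB.pow_smul_top_le_ker_component (p k : ℕ) :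
    (Ideal.span {(p : ℤ)} ^ (k + 1) • ⊤ : Submodule ℤ (StandardB p)) ≤
      (DirectSum.component ℤ ℕ (fun n ↦ ZMod (p ^ (n + 1))) k).ker := by
  intro b hb
  obtain ⟨a, ha⟩ := (StandardB.mem_pow_smul_top_iff p (k + 1) b).1 hb k
  rw [LinearMap.mem_ker]
  change b k = 0
  rw [ha, ZMod.natCast_pow_eq_zero_of_le p le_rfl, zero_mul]

/-- The `k`-th coordinate on the `p`-adic completion of `B`. It is read off from the component in
`B / p ^ (k + 1) B`, since `p ^ (k + 1)` kills the `k`-th summand of `B`. -/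
noncomputable def completedCoord (p k : ℕ) : CompletedB p →+ ZMod (p ^ (k + 1)) :=
  (((Ideal.span {(p : ℤ)} ^ (k + 1) • ⊤ : Submodule ℤ (StandardB p)).liftQ
    (DirectSum.component ℤ ℕ (fun n ↦ ZMod (p ^ (n + 1))) k)
    (StandardB.pow_smul_top_le_ker_component p k)).comp
    (AdicCompletion.eval (Ideal.span {(p : ℤ)}) (StandardB p) (k + 1))).toAddMonoidHom

theorem completedCoord_eq {p k : ℕ} {y : CompletedB p} {b : StandardB p}
    (h : y.val (k + 1) = Submodule.Quotient.mk b) : completedCoord p k y = b k := by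
  exact congrArg (Submodule.liftQ _ _ (StandardB.pow_smul_top_le_ker_component p k)) h

/-- A representative in `B` of an element of the completion modulo `p ^ m` has the same
coordinates modulo `p ^ m`. -/
theorem exists_sub_completedCoord_eq {p m : ℕ} {y : CompletedB p} {b : StandardB p}
    (h : y.val m = Submodule.Quotient.mk b) (k : ℕ) :
    ∃ a, b k - completedCoord p k y = (p : ZMod (p ^ (k + 1))) ^ m * a := by
  obtain ⟨b', hb'⟩ := Submodule.Quotient.mk_surjective _ (y.val (max m (k + 1)))
  have h1 : y.val m = Submodule.Quotient.mk b' := by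
    rw [← y.2 (le_max_left m (k + 1)), ← hb']
    rfl
  have h2 : y.val (k + 1) = Submodule.Quotient.mk b' := by
    rw [← y.2 (le_max_right m (k + 1)), ← hb']
    rfl
  rw [completedCoord_eq h2]
  exact (StandardB.mem_pow_smul_top_iff p m (b - b')).1
    ((Submodule.Quotient.eq _).1 (h.symm.trans h1)) k

theorem CompletedB.ext_coord {p : ℕ} {y z : CompletedB p}
    (h : ∀ k, completedCoord p k y = completedCoord p k z) : y = z := by
  rw [← sub_eq_zero]
  refine AdicCompletion.ext fun m ↦ ?_
  obtain ⟨b, hb⟩ := Submodule.Quotient.mk_surjective _ ((y - z).val m)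
  change (y - z).val m = 0
  rw [← hb]
  refine (Submodule.Quotient.mk_eq_zero _).2
    ((StandardB.mem_pow_smul_top_iff p m b).2 fun k ↦ ?_)
  obtain ⟨a, ha⟩ := exists_sub_completedCoord_eq hb.symm k
  exact ⟨a, by rw [← ha, map_sub, h k, sub_self, sub_zero]⟩

open DirectSum in
theorem StandardB.sum_of_apply {p : ℕ} (s : Finset ℕ) (a : ∀ k, ZMod (p ^ (k + 1))) (j : ℕ) :
    (∑ k ∈ s, of (fun n ↦ ZMod (p ^ (n + 1))) k (a k)) j = if j ∈ s then a j else 0 := by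
  classical
  rw [DirectSum.sum_apply]
  split_ifs with h
  · rw [Finset.sum_eq_single_of_mem j h, DirectSum.of_eq_same]
    intro i _ hij
    exact DirectSum.of_eq_of_ne _ _ _ hij.symm
  · refine Finset.sum_eq_zero fun i hi ↦ DirectSum.of_eq_of_ne _ _ _ ?_
    rintro rfl
    exact h hi

/-- Families of coordinates killed by a fixed power `p ^ n` come from the completion: such an `a k`
is divisible by `p ^ (k + 1 - n)`, so the partial sums form a `p`-adic Cauchy sequence. -/
theorem CompletedB.exists_coord_eq {p : ℕ} (hp : p.Prime) (n : ℕ) (a : ∀ k, ZMod (p ^ (k + 1)))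
    (ha : ∀ k, (p : ZMod (p ^ (k + 1))) ^ n * a k = 0) :
    ∃ y : CompletedB p, ∀ k, completedCoord p k y = a k := by
  let S : ℕ → StandardB p := fun m ↦ ∑ k ∈ Finset.range (m + n), DirectSum.of _ k (a k)
  have hS (m k : ℕ) : S m k = if k ∈ Finset.range (m + n) then a k else 0 :=
    StandardB.sum_of_apply _ _ _
  refine ⟨⟨fun m ↦ Submodule.Quotient.mk (S m), fun {m m'} hm ↦ ?_⟩, fun k ↦ ?_⟩
  · change Submodule.Quotient.mk (S m') = Submodule.Quotient.mk (S m)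
    refine (Submodule.Quotient.eq _).2 ((StandardB.mem_pow_smul_top_iff p m _).2 fun k ↦ ?_)
    rw [DirectSum.sub_apply, hS, hS]
    simp only [Finset.mem_range]
    by_cases h1 : k < m + n
    · exact ⟨0, by simp [h1, show k < m' + n by omega]⟩
    · obtain ⟨u, hu⟩ := ZMod.exists_eq_pow_mul_of_pow_mul_eq_zero hp (ha k)
      by_cases h2 : k < m' + n
      · refine ⟨(p : ZMod (p ^ (k + 1))) ^ (k + 1 - n - m) * u, ?_⟩
        rw [if_pos h2, if_neg h1, sub_zero, ← mul_assoc, ← pow_add,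
          Nat.add_sub_cancel' (by omega), hu]
      · exact ⟨0, by simp [h1, h2]⟩
  · refine (completedCoord_eq (b := S (k + 1)) rfl).trans ?_
    rw [hS, if_pos (Finset.mem_range.2 (by omega))]

/-- The `k`-th coordinate on the torsion completion of `B`. -/
noncomputable def torsionCoord (p k : ℕ) :
    TorsionCompletion p (StandardB p) →+ ZMod (p ^ (k + 1)) :=
  (completedCoord p k).comp (AddSubgroup.subtype _)

theorem torsionCoord_ext {p : ℕ} {y z : TorsionCompletion p (StandardB p)}
    (h : ∀ k, torsionCoord p k y = torsionCoord p k z) : y = z :=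
  Subtype.ext (CompletedB.ext_coord h)

theorem exists_torsionCoord_eq {p : ℕ} (hp : p.Prime) (n : ℕ) (a : ∀ k, ZMod (p ^ (k + 1)))
    (ha : ∀ k, (p : ZMod (p ^ (k + 1))) ^ n * a k = 0) :
    ∃ y : TorsionCompletion p (StandardB p), ∀ k, torsionCoord p k y = a k := by
  obtain ⟨y, hy⟩ := CompletedB.exists_coord_eq hp n a ha
  refine ⟨⟨y, ?_⟩, hy⟩
  rw [AddCommGroup.mem_torsion, isOfFinAddOrder_iff_nsmul_eq_zero]
  refine ⟨p ^ n, pow_pos hp.pos n, CompletedB.ext_coord fun k ↦ ?_⟩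
  rw [map_nsmul, map_zero, hy, nsmul_eq_mul, Nat.cast_pow, ha]

theorem torsionCoord_nsmul (p k n : ℕ) (y : TorsionCompletion p (StandardB p)) :
    torsionCoord p k (p ^ n • y) = (p : ZMod (p ^ (k + 1))) ^ n * torsionCoord p k y := by
  rw [map_nsmul, nsmul_eq_mul, Nat.cast_pow]

theorem nsmul_eq_zero_iff_torsionCoord {p : ℕ} {y : TorsionCompletion p (StandardB p)} :
    p • y = 0 ↔ ∀ k, (p : ZMod (p ^ (k + 1))) ^ 1 * torsionCoord p k y = 0 := by
  refine ⟨fun h k ↦ ?_, fun h ↦ torsionCoord_ext fun k ↦ ?_⟩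
  · rw [← torsionCoord_nsmul, pow_one, h, map_zero]
  · rw [map_nsmul, map_zero, nsmul_eq_mul, ← h k, pow_one]

/-! ### Primary groups -/

theorem isAddPGroup_standardB (p : ℕ) : IsAddPGroup p (StandardB p) := by
  intro b
  induction b using DirectSum.induction_on with
  | zero => exact ⟨0, smul_zero _⟩
  | of k a =>
    refine ⟨k + 1, ?_⟩
    rw [← map_nsmul, nsmul_eq_mul, Nat.cast_pow, ZMod.natCast_pow_eq_zero_of_le p le_rfl, zero_mul,
      map_zero]
  | add x y hx hy =>
    obtain ⟨k, hk⟩ := hx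
    obtain ⟨l, hl⟩ := hy
    refine ⟨k + l, ?_⟩
    rw [smul_add, pow_add, mul_smul, mul_smul, hl, smul_zero, add_zero, smul_comm, hk, smul_zero]

theorem isAddPGroup_torsionCompletion {p : ℕ} (hp : p.Prime) :
    IsAddPGroup p (TorsionCompletion p (StandardB p)) := by
  intro y
  obtain ⟨n, hn, hy⟩ := isOfFinAddOrder_iff_nsmul_eq_zero.1 y.2
  obtain ⟨k, m, hm, rfl⟩ := Nat.exists_eq_pow_mul_and_not_dvd hn.ne' p hp.ne_one
  refine ⟨k, torsionCoord_ext fun j ↦ ?_⟩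
  have h : torsionCoord p j ((p ^ k * m) • y) = 0 := by
    rw [show (p ^ k * m) • y = 0 from Subtype.ext hy, map_zero]
  rw [mul_comm, mul_smul, map_nsmul, nsmul_eq_mul] at h
  -- `m` is prime to `p`, hence acts invertibly on every coordinate.
  have hu : IsUnit (m : ZMod (p ^ (j + 1))) :=
    (ZMod.isUnit_iff_coprime m _).2 (((hp.coprime_iff_not_dvd.2 hm).symm).pow_right _)
  rw [map_zero]
  exact hu.mul_right_eq_zero.1 h

theorem IsAddPGroup.prod {p : ℕ} {A C : Type*} [AddCommGroup A] [AddCommGroup C]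
    (hA : IsAddPGroup p A) (hC : IsAddPGroup p C) : IsAddPGroup p (A × C) := by
  rintro ⟨a, c⟩
  obtain ⟨k, hk⟩ := hA a
  obtain ⟨l, hl⟩ := hC c
  refine ⟨k + l, Prod.ext ?_ ?_⟩
  · change p ^ (k + l) • a = 0
    rw [pow_add, mul_comm, mul_smul, hk, smul_zero]
  · change p ^ (k + l) • c = 0
    rw [pow_add, mul_smul, hl, smul_zero]

/-! ### Homomorphisms from the torsion completion to `B` -/

/-- An element of the socle of the torsion completion whose coordinates below `n` vanish is
divisible by `p ^ n`. -/
theorem exists_pow_nsmul_eq_of_torsionCoord_eq_zero {p : ℕ} (hp : p.Prime) {n : ℕ}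
    {y : TorsionCompletion p (StandardB p)} (hy : p • y = 0)
    (h : ∀ k < n, torsionCoord p k y = 0) : ∃ w, p ^ n • w = y := by
  have hu (k : ℕ) : ∃ u, torsionCoord p k y = (p : ZMod (p ^ (k + 1))) ^ k * u :=
    ZMod.exists_eq_pow_mul_of_pow_mul_eq_zero (n := 1) hp
      (nsmul_eq_zero_iff_torsionCoord.1 hy k)
  choose u hu using hu
  obtain ⟨w, hw⟩ := exists_torsionCoord_eq hp (n + 1)
    (fun k ↦ if k < n then 0 else (p : ZMod (p ^ (k + 1))) ^ (k - n) * u k) (fun k ↦ by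
      split_ifs with hk
      · exact mul_zero _
      · rw [← mul_assoc, ← pow_add, ZMod.natCast_pow_eq_zero_of_le p (by omega), zero_mul])
  refine ⟨w, torsionCoord_ext fun k ↦ ?_⟩
  rw [torsionCoord_nsmul, hw]
  split_ifs with hk
  · rw [h k hk, mul_zero]
  · rw [← mul_assoc, ← pow_add, Nat.add_sub_cancel' (by omega), hu]

theorem hom_apply_eq_zero_of_torsionCoord_eq_zero {p : ℕ} (hp : p.Prime)
    (α : TorsionCompletion p (StandardB p) →+ StandardB p) {n : ℕ}
    {y : TorsionCompletion p (StandardB p)} (hy : p • y = 0)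
    (h : ∀ k < n, torsionCoord p k y = 0) {j : ℕ} (hj : j < n) : α y j = 0 := by
  obtain ⟨w, rfl⟩ := exists_pow_nsmul_eq_of_torsionCoord_eq_zero hp hy h
  rw [map_nsmul, DirectSum.smul_apply, nsmul_eq_mul, Nat.cast_pow,
    ZMod.natCast_pow_eq_zero_of_le p hj, zero_mul]

theorem StandardB.exists_bound (p : ℕ) (b : StandardB p) : ∃ s, ∀ k, s ≤ k → b k = 0 := by
  classical
  refine ⟨(DFinsupp.support b).sup id + 1, fun k hk ↦ ?_⟩
  by_contra h
  have := Finset.le_sup (f := id) (DFinsupp.mem_support_iff.2 h)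
  simp only [id] at this
  omega

/-- A homomorphism from the torsion completion to `B` kills all socle elements whose first
coordinates vanish. Otherwise a gliding hump argument yields a socle element whose image has
infinitely many nonzero coordinates. -/
theorem exists_hom_eq_zero_of_torsionCoord_eq_zero {p : ℕ} (hp : p.Prime)
    (α : TorsionCompletion p (StandardB p) →+ StandardB p) :
    ∃ n, ∀ y : TorsionCompletion p (StandardB p), p • y = 0 →
      (∀ k < n, torsionCoord p k y = 0) → α y = 0 := by
  by_contra! hcon
  choose x hpx hx hαx using hcon
  choose s hs using fun n ↦ StandardB.exists_bound p (α (x n))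
  have hne (n : ℕ) : ∃ k, α (x n) k ≠ 0 := by
    by_contra! h
    exact hαx n (DFinsupp.ext h)
  choose κ hκ using hne
  have hκle (n : ℕ) : n ≤ κ n := by
    by_contra! h
    exact hκ n (hom_apply_eq_zero_of_torsionCoord_eq_zero hp α (hpx n) (hx n) h)
  have hκs (n : ℕ) : κ n < s n := by
    by_contra! h
    exact hκ n (hs n _ h)
  -- The humps: the image of `x (m i)` is supported in `[m i, m (i + 1))`.
  let m : ℕ → ℕ := fun i ↦ s^[i] 0
  have hm (i : ℕ) : m (i + 1) = s (m i) := Function.iterate_succ_apply' s i 0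
  have hmono : StrictMono m := strictMono_nat_of_lt_succ fun i ↦ by
    rw [hm]
    exact (hκle _).trans_lt (hκs _)
  have hcoord {i k : ℕ} (h : k < m i) : torsionCoord p k (x (m i)) = 0 := hx _ _ h
  have hpc (i k : ℕ) : (p : ZMod (p ^ (k + 1))) ^ 1 * torsionCoord p k (x i) = 0 :=
    nsmul_eq_zero_iff_torsionCoord.1 (hpx i) k
  obtain ⟨z, hz⟩ := exists_torsionCoord_eq hp 1
    (fun k ↦ ∑ i ∈ Finset.range (k + 1), torsionCoord p k (x (m i))) (fun k ↦ by
      rw [Finset.mul_sum]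
      exact Finset.sum_eq_zero fun i _ ↦ hpc _ _)
  have hpz : p • z = 0 := nsmul_eq_zero_iff_torsionCoord.2 fun k ↦ by
    rw [hz, Finset.mul_sum]
    exact Finset.sum_eq_zero fun i _ ↦ hpc _ _
  have hαz (j : ℕ) : α z (κ (m j)) ≠ 0 := by
    let S := ∑ i ∈ Finset.range (j + 1), x (m i)
    have hpS : p • (z - S) = 0 := by
      rw [smul_sub, hpz, Finset.smul_sum, Finset.sum_eq_zero fun i _ ↦ hpx _, sub_zero]
    have hrest : ∀ k < m (j + 1), torsionCoord p k (z - S) = 0 := by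
      intro k hk
      rw [map_sub, hz, map_sum, sub_eq_zero]
      -- Both sums have the same nonzero terms: those with `m i ≤ k`, hence `i ≤ k` and `i ≤ j`.
      rcases le_total k j with h | h
      · refine Finset.sum_subset (Finset.range_subset_range.2 (by omega)) fun i _ hi ↦ hcoord ?_
        have := hmono.le_apply (x := i)
        simp only [Finset.mem_range] at hi
        omega
      · refine (Finset.sum_subset (Finset.range_subset_range.2 (by omega)) fun i _ hi ↦
          hcoord ?_).symm
        simp only [Finset.mem_range] at hi
        exact hk.trans_le (hmono.monotone (by omega))
    have h0 : α (z - S) (κ (m j)) = 0 :=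
      hom_apply_eq_zero_of_torsionCoord_eq_zero hp α hpS hrest ((hκs _).trans_eq (hm j).symm)
    have hS : α S (κ (m j)) = α (x (m j)) (κ (m j)) := by
      rw [map_sum, DirectSum.sum_apply]
      refine Finset.sum_eq_single_of_mem j (Finset.self_mem_range_succ j) fun i hi hij ↦ ?_
      refine hs _ _ ?_
      rw [← hm]
      have hi' : i + 1 ≤ j := by
        have := Finset.mem_range.1 hi
        omega
      exact (hmono.monotone hi').trans (hκle _)
    rw [map_sub, DirectSum.sub_apply, sub_eq_zero] at h0
    rw [h0, hS]
    exact hκ _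
  obtain ⟨t, ht⟩ := StandardB.exists_bound p (α z)
  exact hαz t (ht _ (hmono.le_apply.trans (hκle _)))

/-- The image of the socle of the torsion completion under a homomorphism to `B` is finite: the
homomorphism factors on the socle through finitely many coordinates. -/
theorem finite_image_socle {p : ℕ} (hp : p.Prime)
    (α : TorsionCompletion p (StandardB p) →+ StandardB p) :
    (α '' {y | p • y = 0}).Finite := by
  obtain ⟨n, hn⟩ := exists_hom_eq_zero_of_torsionCoord_eq_zero hp α
  have (k : ℕ) : NeZero (p ^ (k + 1)) := ⟨pow_ne_zero _ hp.ne_zero⟩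
  let f : {y : TorsionCompletion p (StandardB p) // p • y = 0} →
      ∀ k : Fin n, ZMod (p ^ (k.1 + 1)) := fun y k ↦ torsionCoord p k y.1
  have hf : Function.FactorsThrough (fun y ↦ α y.1) f := by
    intro y z hyz
    refine sub_eq_zero.1 ((map_sub α y.1 z.1).symm.trans (hn _ ?_ fun k hk ↦ ?_))
    · rw [smul_sub, y.2, z.2, sub_zero]
    · rw [map_sub, sub_eq_zero]
      exact congrFun hyz ⟨k, hk⟩
  refine (Set.finite_range (Function.extend f (fun y ↦ α y.1) 0)).subset ?_
  rintro _ ⟨y, hy, rfl⟩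
  exact ⟨f ⟨y, hy⟩, hf.extend_apply 0 ⟨y, hy⟩⟩

/-! ### Inertia of the socle -/

theorem mem_zeroSumSocle_iff {p : ℕ} {A : Type*} [AddCommGroup A]
    {x : A × TorsionCompletion p A} : x ∈ zeroSumSocle p A ↔ x.1 = 0 ∧ p • x.2 = 0 := by
  rw [← natCast_zsmul]
  rfl

theorem AddSubgroup.card_inertiaQuotient {G : Type*} [AddCommGroup G] (φ : G →+ G)
    (X : AddSubgroup G) : Nat.card (InertiaQuotient φ X) = X.relIndex (X.map φ) :=
  AddSubgroup.relIndex_sup_right _ _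

theorem AddSubgroup.finite_inertiaQuotient_iff {G : Type*} [AddCommGroup G] (φ : G →+ G)
    (X : AddSubgroup G) : Finite (InertiaQuotient φ X) ↔ X.relIndex (X.map φ) ≠ 0 := by
  rw [← AddSubgroup.card_inertiaQuotient, Nat.card_ne_zero]
  exact ⟨fun h ↦ ⟨⟨0⟩, h⟩, And.right⟩

/-- An endomorphism moves `0 ⊕ Ā[p]` only in the direction of `A`, because socles are mapped to
socles. Its inertia is therefore measured by the projection to `A`. -/
theorem relIndex_zeroSumSocle {p : ℕ} {A : Type*} [AddCommGroup A]
    (φ : A × TorsionCompletion p A →+ A × TorsionCompletion p A) :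
    (zeroSumSocle p A).relIndex ((zeroSumSocle p A).map φ) =
      Nat.card (((zeroSumSocle p A).map φ).map (AddMonoidHom.fst A (TorsionCompletion p A))) := by
  rw [← AddSubgroup.relIndex_ker, ← AddSubgroup.inf_relIndex_right, ← AddSubgroup.inf_relIndex_right
    (AddMonoidHom.ker _)]
  congr 1
  ext x
  simp only [AddSubgroup.mem_inf]
  refine and_congr_left ?_
  rintro ⟨y, hy, rfl⟩
  rw [mem_zeroSumSocle_iff]
  refine and_iff_left ?_
  have hy' : p • y = 0 := by
    obtain ⟨h1, h2⟩ := mem_zeroSumSocle_iff.1 hy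
    exact Prod.ext (by rw [Prod.smul_fst, h1, smul_zero]; rfl) h2
  have h := congrArg Prod.snd (map_nsmul φ p y)
  rw [hy', map_zero] at h
  exact h.symm

theorem isFullyInert_zeroSumSocle {p : ℕ} (hp : p.Prime) :
    IsFullyInert (zeroSumSocle p (StandardB p)) := by
  intro φ
  rw [AddSubgroup.finite_inertiaQuotient_iff, relIndex_zeroSumSocle, Nat.card_ne_zero]
  refine ⟨⟨0⟩, Set.Finite.subset (finite_image_socle hp
    (((AddMonoidHom.fst _ _).comp φ).comp (AddMonoidHom.inr _ _))) ?_⟩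
  rintro _ ⟨_, ⟨⟨b, y⟩, hy, rfl⟩, rfl⟩
  obtain ⟨h1, h2⟩ := mem_zeroSumSocle_iff.1 hy
  obtain rfl : b = 0 := h1
  exact ⟨y, h2, rfl⟩

/-! ### Shears -/

/-- The automorphism `(a, c) ↦ (a + α c, c)` of `A × C` given by a homomorphism `α : C → A`. -/
def AddMonoidHom.shear {A C : Type*} [AddCommGroup A] [AddCommGroup C] (α : C →+ A) :
    A × C ≃+ A × C where
  toFun x := (x.1 + α x.2, x.2)
  invFun x := (x.1 - α x.2, x.2)
  left_inv x := by simp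
  right_inv x := by simp
  map_add' x y := by
    refine Prod.ext ?_ rfl
    change x.1 + y.1 + α (x.2 + y.2) = x.1 + α x.2 + (y.1 + α y.2)
    rw [map_add]
    abel

/-- The homomorphism from the torsion completion to `B` that keeps the coordinates below `N`. -/
noncomputable def truncation (p N : ℕ) :
    TorsionCompletion p (StandardB p) →+ StandardB p :=
  ∑ k ∈ Finset.range N, (DirectSum.of (fun n ↦ ZMod (p ^ (n + 1))) k).comp (torsionCoord p k)

theorem truncation_apply (p N : ℕ) (y : TorsionCompletion p (StandardB p)) (j : ℕ) :
    truncation p N y j = if j ∈ Finset.range N then torsionCoord p j y else 0 := by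
  rw [← StandardB.sum_of_apply (Finset.range N) (fun k ↦ torsionCoord p k y), truncation,
    AddMonoidHom.finsetSum_apply]
  rfl

/-- Shearing by the first `N` coordinates gives inertia at least `N`: in the projection to `B` the
generators of the socles of the first `N` summands become visible. -/
theorem not_isUniformlyCharacteristicallyInert_zeroSumSocle {p : ℕ} (hp : p.Prime) :
    ¬ IsUniformlyCharacteristicallyInert (zeroSumSocle p (StandardB p)) := by
  rintro ⟨M, hM⟩
  have hpow (k : ℕ) : (p : ZMod (p ^ (k + 1))) ^ k ≠ 0 := by
    have h : ((p ^ k : ℕ) : ZMod (p ^ (k + 1))) ≠ 0 := by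
      rw [Ne, ZMod.natCast_eq_zero_iff, Nat.pow_dvd_pow_iff_le_right hp.one_lt]
      omega
    exact_mod_cast h
  have he (i : ℕ) : ∃ e : TorsionCompletion p (StandardB p), ∀ k,
      torsionCoord p k e = if k = i then (p : ZMod (p ^ (k + 1))) ^ k else 0 :=
    exists_torsionCoord_eq hp 1 _ fun k ↦ by
      split_ifs
      · rw [← pow_add, ZMod.natCast_pow_eq_zero_of_le p (by omega)]
      · exact mul_zero _
  choose e he using he
  have hpe (i : ℕ) : p • e i = 0 := nsmul_eq_zero_iff_torsionCoord.2 fun k ↦ by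
    rw [he]
    split_ifs
    · rw [← pow_add, ZMod.natCast_pow_eq_zero_of_le p (by omega)]
    · exact mul_zero _
  let φ := (truncation p (M + 1)).shear
  obtain ⟨hfin, hcard⟩ := hM φ
  rw [AddSubgroup.finite_inertiaQuotient_iff] at hfin
  rw [AddSubgroup.card_inertiaQuotient] at hcard
  rw [relIndex_zeroSumSocle] at hfin hcard
  have := (Nat.card_ne_zero.1 hfin).2
  let g : Fin (M + 1) → ((zeroSumSocle p (StandardB p)).map (φ : _ →+ _)).map
      (AddMonoidHom.fst _ _) := fun i ↦
    ⟨truncation p (M + 1) (e i), (0 + truncation p (M + 1) (e i), e i),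
      ⟨(0, e i), mem_zeroSumSocle_iff.2 ⟨rfl, hpe i⟩, rfl⟩, zero_add _⟩
  have hg : Function.Injective g := by
    intro i j hij
    have h : truncation p (M + 1) (e i) i.1 = truncation p (M + 1) (e j) i.1 :=
      congrArg (fun b : StandardB p ↦ b i.1) (congrArg Subtype.val hij)
    rw [truncation_apply, truncation_apply, if_pos (Finset.mem_range.2 i.2),
      if_pos (Finset.mem_range.2 i.2), he, he, if_pos rfl] at h
    by_contra hne
    rw [if_neg (fun h' ↦ hne (Fin.ext h'))] at h
    exact hpow _ h
  have := Nat.card_le_card_of_injective g hg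
  rw [Nat.card_fin] at this
  omega

/-! ### Commensurability with characteristic subgroups -/

/-- If `Y` is characteristic and commensurable with `X`, then every automorphic image of `X` is
commensurable with `Y`, with the same index of `Y`, and so has bounded index over `X`. -/
theorem AddSubgroup.Commensurable.isUniformlyCharacteristicallyInert {G : Type*} [AddCommGroup G]
    {X Y : AddSubgroup G} (h : X.Commensurable Y) (hY : Y.Characteristic) :
    IsUniformlyCharacteristicallyInert X := by
  refine ⟨X.relIndex Y * Y.relIndex X, fun φ ↦ ?_⟩
  have hφ : Y.relIndex (X.map (φ : G →+ G)) = Y.relIndex X := by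
    conv_lhs => rw [← AddSubgroup.characteristic_iff_map_eq.1 hY φ]
    exact AddSubgroup.relIndex_map_map_of_injective (f := φ.toAddMonoidHom) _ _ φ.injective
  rw [AddSubgroup.finite_inertiaQuotient_iff, AddSubgroup.card_inertiaQuotient]
  refine ⟨AddSubgroup.relIndex_ne_zero_trans h.1 (hφ ▸ h.2), ?_⟩
  rw [← hφ]
  have h2 := AddSubgroup.relIndex_inf_mul_relIndex X Y (X.map (φ : G →+ G))
  calc X.relIndex (X.map (φ : G →+ G))
      ≤ (X ⊓ Y).relIndex (X.map (φ : G →+ G)) :=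
        AddSubgroup.relIndex_le_of_le_left inf_le_left (by
          rw [← h2]
          exact mul_ne_zero (fun h0 ↦ h.1 (AddSubgroup.relIndex_eq_zero_of_le_right inf_le_left h0))
            (hφ ▸ h.2))
    _ = X.relIndex (Y ⊓ X.map (φ : G →+ G)) * Y.relIndex (X.map (φ : G →+ G)) := h2.symm
    _ ≤ X.relIndex Y * Y.relIndex (X.map (φ : G →+ G)) :=
        Nat.mul_le_mul_right _ (AddSubgroup.relIndex_le_of_le_right inf_le_left h.1)

theorem IsFullyInvariantSubgroup.characteristic {G : Type*} [AddCommGroup G] {Y : AddSubgroup G}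
    (h : IsFullyInvariantSubgroup Y) : Y.Characteristic :=
  AddSubgroup.characteristic_iff_map_le.2 fun φ ↦ h φ.toAddMonoidHom

theorem mainTheorem5 (p : ℕ) (hp : p.Prime) :
    IsAddPGroup p (StandardB p × TorsionCompletion p (StandardB p)) ∧
    ¬ HasMinimalFullInertia (StandardB p × TorsionCompletion p (StandardB p)) ∧
    ¬ HasMinimalCharacteristicInertia (StandardB p × TorsionCompletion p (StandardB p)) ∧
    IsFullyInert (zeroSumSocle p (StandardB p)) ∧
    ¬ IsUniformlyCharacteristicallyInert (zeroSumSocle p (StandardB p)) ∧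
    ¬ ∃ Y : AddSubgroup (StandardB p × TorsionCompletion p (StandardB p)),
        Y.Characteristic ∧ (zeroSumSocle p (StandardB p)).Commensurable Y := by
  have hnot : ¬ ∃ Y : AddSubgroup (StandardB p × TorsionCompletion p (StandardB p)),
      Y.Characteristic ∧ (zeroSumSocle p (StandardB p)).Commensurable Y := by
    rintro ⟨Y, hY, hXY⟩
    exact not_isUniformlyCharacteristicallyInert_zeroSumSocle hp
      (hXY.isUniformlyCharacteristicallyInert hY)
  have hinert := isFullyInert_zeroSumSocle hp
  refine ⟨(isAddPGroup_standardB p).prod (isAddPGroup_torsionCompletion hp), fun h ↦ ?_,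
    fun h ↦ hnot (h _ fun φ ↦ hinert φ), hinert,
    not_isUniformlyCharacteristicallyInert_zeroSumSocle hp, hnot⟩
  obtain ⟨Y, hY, hXY⟩ := h _ hinert
  exact hnot ⟨Y, hY.characteristic, hXY⟩
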